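/- Let $n\ge 2$ be an integer. Let $A_n=(a_{i,j})_{1\le i,j\le n}$ and $B_n=(b_{i,j})_{1\le i,j\le n}$ be the real matrices with entries $$a_{i,j}=\frac{1-(-1)^{i+j-1}}{i+j-1},\qquad b_{i,j}=(i-1)(j-1)\,\frac{1-(-1)^{i+j-3}}{i+j-3},$$ where $b_{i,j}$ is understood to be $0$ if $i=1$ or $j=1$, and let $$F_n(\lambda)=\sum_{j=0}^{\nu}(-4)^{j-\nu}\,\frac{(2\nu-2j+1)_n}{(2j-2\nu+n)!}\,\lambda^j,\qquad \nu=\lfloor n/2\rfloor,$$ where $(a)_n=a(a+1)\cdots(a+n-1)$ is the rising factorial. Let $\hat\Omega=(-1,1)^2$, let $\hat V_n$ be the real linear span of the functions $x^iy^j$, $0\le i,j<n$, and let $$\hat c_1(n)=\sup_{0\ne v\in\hat V_n}\frac{\|\partial_x v\|_{L^2(\hat\Omega)}}{\|v\|_{L^2(\hat\Omega)}}$$ be the optimal constant in the inverse inequality $\|\partial_x v\|_{L^2(\hat\Omega)}\le c\,\|v\|_{L^2(\hat\Omega)}$ for all $v\in\hat V_n$. Then $F_n$ has a largest real root $\lambda_n$,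 and $\lambda_n$ is also the largest real root of $\det(B_n-\lambda A_n)$ as a polynomial in $\lambda$. Moreover, the supremum $\hat c_1(n)$ is finite, and $\hat c_1(n)^2=\lambda_n$. -/

import Mathlib

noncomputable section

namespace InverseInequality

open MeasureTheory

/-- The entry `a_{i,j} = (1 - (-1)^(i+j-1)) / (i+j-1)`, for indices `i, j ≥ 1`. -/
def a (i j : ℕ) : ℝ :=
  (1 - (-1 : ℝ) ^ ((i : ℤ) + (j : ℤ) - 1)) / ((i : ℝ) + (j : ℝ) - 1)

/-- The entry `b_{i,j} = (i-1) (j-1) (1 - (-1)^(i+j-3)) / (i+j-3)`, for indices `i, j ≥ 1`.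
If `i = 1` or `j = 1`, the entry is `0`; this includes the case `i + j = 3`, where the quotient
has denominator `0`. -/
def b (i j : ℕ) : ℝ :=
  ((i : ℝ) - 1) * ((j : ℝ) - 1) *
    ((1 - (-1 : ℝ) ^ ((i : ℤ) + (j : ℤ) - 3)) / ((i : ℝ) + (j : ℝ) - 3))

/-- The `n × n` matrix with entries `a_{i,j}`, `1 ≤ i, j ≤ n`. -/
def A (n : ℕ) : Matrix (Fin n) (Fin n) ℝ :=
  Matrix.of fun i j => a ((i : ℕ) + 1) ((j : ℕ) + 1)

/-- The `n × n` matrix with entries `b_{i,j}`, `1 ≤ i, j ≤ n`. -/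
def B (n : ℕ) : Matrix (Fin n) (Fin n) ℝ :=
  Matrix.of fun i j => b ((i : ℕ) + 1) ((j : ℕ) + 1)

/-- The polynomial `F_n(λ) = ∑_{j=0}^ν (-4)^(j-ν) (2ν-2j+1)_n / (2j-2ν+n)! λ^j`, `ν = ⌊n/2⌋`,
where `(x)_n` is the rising factorial. As `2ν ≤ n`, the subtraction in the factorial is exact. -/
def F (n : ℕ) : Polynomial ℝ :=
  ∑ j ∈ Finset.range (n / 2 + 1),
    Polynomial.C
      ((-4 : ℝ) ^ ((j : ℤ) - ((n / 2 : ℕ) : ℤ)) *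
        ((ascPochhammer ℝ n).eval (2 * ((n / 2 : ℕ) : ℝ) - 2 * (j : ℝ) + 1) /
          ((2 * j + n - 2 * (n / 2)).factorial : ℝ))) *
      Polynomial.X ^ j

/-- The open reference square `(-1,1)²`. -/
def square : Set (ℝ × ℝ) := Set.Ioo (-1) 1 ×ˢ Set.Ioo (-1) 1

/-- The space of (functions defined by) real polynomials in two variables of degree less than `n`
in each variable: the linear span of `x^i y^j`, `0 ≤ i, j < n`. -/
def V (n : ℕ) : Submodule ℝ (ℝ × ℝ → ℝ) :=
  Submodule.span ℝ {φ | ∃ i < n, ∃ j < n, φ = fun p : ℝ × ℝ => p.1 ^ i * p.2 ^ j}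

/-- The partial derivative with respect to the first variable. -/
def dx (u : ℝ × ℝ → ℝ) : ℝ × ℝ → ℝ := fun p => deriv (fun s => u (s, p.2)) p.1

/-- The `L²` inner product on the reference square. -/
def innerY (u v : ℝ × ℝ → ℝ) : ℝ := ∫ p in square, u p * v p

/-- The `L²` inner product of the first partial derivatives on the reference square. -/
def innerX (u v : ℝ × ℝ → ℝ) : ℝ := ∫ p in square, dx u p * dx v p

/-- The norm `‖v‖` in `L²((-1,1)²)`. -/
def normY (v : ℝ × ℝ → ℝ) : ℝ := Real.sqrt (innerY v v)

/-- The (semi)norm `‖∂ₓ v‖` in `L²((-1,1)²)`. -/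
def normX (v : ℝ × ℝ → ℝ) : ℝ := Real.sqrt (innerX v v)

/-- The quotients `‖∂ₓ v‖ / ‖v‖` for nonzero `v` in `V n`. -/
def quotients (n : ℕ) : Set ℝ := {r | ∃ v ∈ V n, v ≠ 0 ∧ r = normX v / normY v}

/-- The optimal constant in `‖∂ₓ v‖ ≤ c ‖v‖`, `v ∈ V n`: the supremum of the quotients. -/
def cHat (n : ℕ) : ℝ := sSup (quotients n)

end InverseInequality

end

noncomputable section

namespace InverseInequality

open MeasureTheory Polynomial

/-! Freezing `y` reduces the inverse inequality to one variable: `cHat n ^ 2` is the maximum `lam`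
of `∫ u'² / ∫ u²` over nonzero polynomials of degree `< n`. A maximizer satisfies the weak
eigenvalue equation (`isEigen_of_max`), and `A n`, `B n` are the Gram matrices of the two forms, so
`lam` is the largest root of the determinant.

For `F n`, let `Q` be the unnormalized Legendre polynomial of degree `n` and `w` the polynomial
solution of `x w + w'' = Q'`. Up to a nonzero factor, `F n` at `x ≠ 0` is `Q(1) - w'(1)`
(`F_eval_mul`). If this vanishes for some `x > 0`, then `w` has Rayleigh quotient `x`, hence `x ≤
lam`. Conversely, a maximizer `u` has the parity of `n - 1`: otherwise its part of the wrong parity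
would be an eigenfunction of lower degree, and multiplication by the variable would raise its
quotient above the maximum (`IsEigen.lt_of_degree_lt`). Parity makes `lam u + u''` a multiple of
`Q'`, so `u` is a multiple of `w`, and comparing derivatives at `1` gives the root. -/

/-- The linear functional `p ↦ ∫_{-1}^1 p` on real polynomials. -/
def integ : ℝ[X] →ₗ[ℝ] ℝ where
  toFun p := ∫ x in (-1 : ℝ)..1, p.eval x
  map_add' p q := by
    simp only [eval_add]
    exact intervalIntegral.integral_add (p.continuous.intervalIntegrable _ _)
      (q.continuous.intervalIntegrable _ _)
  map_smul' c p := by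
    simp only [eval_smul, RingHom.id_apply]
    exact intervalIntegral.integral_smul _ _

lemma integ_apply (p : ℝ[X]) : integ p = ∫ x in (-1 : ℝ)..1, p.eval x := rfl

lemma integ_C_mul (c : ℝ) (p : ℝ[X]) : integ (C c * p) = c * integ p := by
  rw [← smul_eq_C_mul, map_smul, smul_eq_mul]

lemma integ_derivative (p : ℝ[X]) : integ (derivative p) = p.eval 1 - p.eval (-1) := by
  rw [integ_apply]
  exact intervalIntegral.integral_eq_sub_of_hasDerivAt (fun x _ => p.hasDerivAt x)
    (p.derivative.continuous.intervalIntegrable _ _)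

lemma integ_derivative_mul (p q : ℝ[X]) :
    integ (derivative p * q) = p.eval 1 * q.eval 1 - p.eval (-1) * q.eval (-1)
      - integ (p * derivative q) := by
  have h := integ_derivative (p * q)
  rw [derivative_mul, map_add, eval_mul, eval_mul] at h
  linarith

lemma integ_comp_neg (p : ℝ[X]) : integ (p.comp (-X)) = integ p := by
  simp only [integ_apply, eval_comp, eval_neg, eval_X]
  rw [intervalIntegral.integral_comp_neg (fun x => p.eval x), neg_neg]

lemma integ_nonneg {p : ℝ[X]} (h : ∀ x ∈ Set.Icc (-1 : ℝ) 1, 0 ≤ p.eval x) : 0 ≤ integ p :=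
  intervalIntegral.integral_nonneg (by norm_num) h

lemma integ_mul_self_nonneg (p : ℝ[X]) : 0 ≤ integ (p * p) :=
  integ_nonneg fun x _ => by rw [eval_mul]; exact mul_self_nonneg _

lemma integ_mul_self_pos {p : ℝ[X]} (hp : p ≠ 0) : 0 < integ (p * p) := by
  refine lt_of_le_of_ne (integ_mul_self_nonneg p) fun h => hp ?_
  refine eq_zero_of_infinite_isRoot p ((Set.Ioc_infinite (by norm_num : (-1 : ℝ) < 1)).mono ?_)
  intro x hx
  by_contra hne
  have : 0 < ∫ x in (-1 : ℝ)..1, (p * p).eval x := by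
    refine intervalIntegral.integral_pos (by norm_num) (p * p).continuous.continuousOn
      (fun y _ => by rw [eval_mul]; exact mul_self_nonneg _) ⟨x, ⟨hx.1.le, hx.2⟩, ?_⟩
    rw [eval_mul]
    exact mul_self_pos.2 hne
  exact this.ne h

lemma derivative_comp_neg (p : ℝ[X]) :
    derivative (p.comp (-X)) = -(derivative p).comp (-X) := by
  simp [derivative_comp]

lemma degree_derivative_lt_of_lt {p : ℝ[X]} {n : ℕ} (hp : p.degree < n) :
    (derivative p).degree < n :=
  (degree_derivative_le).trans_lt hp

lemma degree_derivative_add_one_lt {p : ℝ[X]} {n : ℕ} (hp : p.degree < (n + 1 : ℕ)) :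
    (derivative p).degree < n := by
  by_cases h : p = 0
  · subst h
    simp
  · rw [degree_eq_natDegree h, Nat.cast_lt] at hp
    exact (degree_derivative_lt h).trans_le (by
      rw [degree_eq_natDegree h, Nat.cast_le]; omega)

/-! ### Weak eigenfunctions -/

/-- The polynomials solving the variational eigenvalue problem
`∫ u' q' = x ∫ u q` for all `q` of degree less than `n`. -/
structure IsEigen (n : ℕ) (x : ℝ) (u : ℝ[X]) : Prop where
  degree_lt : u.degree < n
  integ_eq : ∀ q : ℝ[X], q.degree < n →
    integ (derivative u * derivative q) = x * integ (u * q)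

lemma IsEigen.sub {n : ℕ} {x : ℝ} {u v : ℝ[X]} (hu : IsEigen n x u) (hv : IsEigen n x v) :
    IsEigen n x (u - v) where
  degree_lt := (degree_sub_le _ _).trans_lt (max_lt hu.degree_lt hv.degree_lt)
  integ_eq q hq := by
    rw [derivative_sub, sub_mul, sub_mul, map_sub, map_sub, hu.integ_eq q hq, hv.integ_eq q hq]
    ring

lemma IsEigen.C_mul {n : ℕ} {x : ℝ} {u : ℝ[X]} (hu : IsEigen n x u) (c : ℝ) :
    IsEigen n x (C c * u) where
  degree_lt := by
    rw [← smul_eq_C_mul]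
    exact (degree_smul_le _ _).trans_lt hu.degree_lt
  integ_eq q hq := by
    rw [derivative_C_mul, mul_assoc, mul_assoc, integ_C_mul, integ_C_mul, hu.integ_eq q hq]
    ring

lemma IsEigen.comp_neg {n : ℕ} {x : ℝ} {u : ℝ[X]} (hu : IsEigen n x u) :
    IsEigen n x (u.comp (-X)) where
  degree_lt := by rw [degree_comp_neg_X]; exact hu.degree_lt
  integ_eq q hq := by
    have h := hu.integ_eq (q.comp (-X)) (by rwa [degree_comp_neg_X])
    rw [← integ_comp_neg, ← integ_comp_neg (u * _), mul_comp_neg_X, mul_comp_neg_X,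
      derivative_comp_neg, neg_comp, comp_neg_X_comp_neg_X, comp_neg_X_comp_neg_X] at h
    rw [derivative_comp_neg, neg_mul, ← h, mul_neg]

/-- An eigenfunction of nonmaximal degree is not a maximizer of the Rayleigh quotient:
multiplication by the variable increases the quotient. -/
lemma IsEigen.lt_of_degree_lt {n : ℕ} {x : ℝ} {u : ℝ[X]} (hx : 0 < x) (hu0 : u ≠ 0)
    (hu : IsEigen (n + 1) x u) (hdeg : u.degree < n) :
    x * integ (X * u * (X * u)) < integ (derivative (X * u) * derivative (X * u)) := by
  -- The strong residual `r` is orthogonal to `(1 - X²) u''`, whose boundary values vanish. Hence `x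
  -- ∫ (1 - X²) u r = ∫ (1 - X²) r² ≥ 0`. The gap to be shown positive equals `∫ u² + ∫ (1 - X²) u
  -- r`.
  set r : ℝ[X] := C x * u + derivative (derivative u) with hr
  have e1 : integ (derivative (X * u) * derivative (X * u)) =
      integ (u * u) + integ (derivative u * derivative (X * X * u)) := by
    rw [← map_add]
    congr 1
    simp only [derivative_mul, derivative_X]
    ring
  have e2 : integ (derivative u * derivative (X * X * u)) =
      integ (derivative u * derivative u) -
        integ (derivative ((1 - X * X) * u) * derivative u) := by
    rw [← map_sub]
    congr 1
    simp only [derivative_mul, derivative_X, derivative_sub, derivative_one]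
    ring
  have e3 := hu.integ_eq u hu.degree_lt
  have e4 := integ_derivative_mul ((1 - X * X) * u) (derivative u)
  have e5 : x * integ (u * u) = x * integ (X * u * (X * u)) + x * integ ((1 - X * X) * u * u) := by
    rw [← mul_add, ← map_add]
    congr 2
    ring
  have e6 : integ ((1 - X * X) * u * r) = x * integ ((1 - X * X) * u * u) +
      integ ((1 - X * X) * u * derivative (derivative u)) := by
    rw [← integ_C_mul, ← map_add]
    congr 1
    rw [hr]; ring
  have e7 : x * integ ((1 - X * X) * u * r) + integ ((1 - X * X) * derivative (derivative u) * r)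
      = integ ((1 - X * X) * (r * r)) := by
    rw [← integ_C_mul, ← map_add]
    congr 1
    rw [hr]; ring
  have hq : ((1 - X * X) * derivative (derivative u) : ℝ[X]).degree < (n + 1 : ℕ) := by
    by_cases h0 : derivative (derivative u) = 0
    · rw [h0, mul_zero, degree_zero]; exact WithBot.bot_lt_coe _
    have h1 : natDegree u < n := (natDegree_lt_iff_degree_lt hu0).2 hdeg
    have h2 : u.natDegree ≠ 0 := fun h => h0 (by
      rw [eq_C_of_natDegree_eq_zero h]; simp)
    have h3 : (derivative u).natDegree ≠ 0 := fun h => h0 (by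
      rw [eq_C_of_natDegree_eq_zero h]; simp)
    have h4 := natDegree_derivative_lt h2
    have h5 := natDegree_derivative_lt h3
    have h6 : (1 - X * X : ℝ[X]).natDegree ≤ 2 := by compute_degree
    refine degree_le_natDegree.trans_lt (Nat.cast_lt.2 ?_)
    have := natDegree_mul_le (p := (1 - X * X : ℝ[X])) (q := derivative (derivative u))
    omega
  have e8 := hu.integ_eq _ hq
  have e9 := integ_derivative_mul (derivative u) ((1 - X * X) * derivative (derivative u))
  have e10 : integ ((1 - X * X) * derivative (derivative u) * r) =
      x * integ (u * ((1 - X * X) * derivative (derivative u))) +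
      integ (derivative (derivative u) * ((1 - X * X) * derivative (derivative u))) := by
    rw [← integ_C_mul, ← map_add]
    congr 1
    rw [hr]; ring
  have e11 : 0 ≤ integ ((1 - X * X) * (r * r)) := by
    refine integ_nonneg fun y hy => ?_
    simp only [eval_mul, eval_sub, eval_one, eval_X]
    exact mul_nonneg (by nlinarith [hy.1, hy.2]) (mul_self_nonneg _)
  have e12 := integ_mul_self_pos hu0
  simp only [eval_mul, eval_sub, eval_one, eval_X] at e4 e9
  have e13 : 0 ≤ x * integ ((1 - X * X) * u * r) := by linarith
  have e14 := nonneg_of_mul_nonneg_right e13 hx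
  linarith

/-! ### Legendre polynomials -/

/-- The Legendre polynomial of degree `n`, normalized as in Rodrigues' formula without the
leading factor: the `n`-th derivative of `(x² - 1)^n`. -/
def rodrigues (n : ℕ) : ℝ[X] := derivative^[n] ((X ^ 2 - 1) ^ n)

lemma eval_iterate_derivative_eq_zero {n k : ℕ} (hk : k < n) {t : ℝ} (ht : t ^ 2 = 1) :
    (derivative^[k] ((X ^ 2 - 1 : ℝ[X]) ^ n)).eval t = 0 := by
  obtain ⟨g, hg⟩ := pow_sub_dvd_iterate_derivative_pow (X ^ 2 - 1 : ℝ[X]) n k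
  have h0 : (X ^ 2 - 1 : ℝ[X]).eval t = 0 := by simp [ht]
  rw [hg, eval_mul, eval_pow, h0, zero_pow (by omega), zero_mul]

lemma integ_iterate_derivative_mul {n k : ℕ} (hk : k ≤ n) (q : ℝ[X]) :
    integ (derivative^[k] ((X ^ 2 - 1) ^ n) * q) =
      (-1) ^ k * integ ((X ^ 2 - 1) ^ n * derivative^[k] q) := by
  induction k generalizing q with
  | zero => simp
  | succ k ih =>
    rw [Function.iterate_succ_apply', integ_derivative_mul,
      eval_iterate_derivative_eq_zero hk (by norm_num),
      eval_iterate_derivative_eq_zero hk (by norm_num), ih (by omega),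
      ← Function.iterate_succ_apply]
    ring

lemma integ_rodrigues_mul {n : ℕ} {q : ℝ[X]} (hq : q.degree < n) :
    integ (rodrigues n * q) = 0 := by
  rw [rodrigues, integ_iterate_derivative_mul le_rfl,
    iterate_derivative_eq_zero_of_degree_lt hq, mul_zero, map_zero, mul_zero]

lemma iterate_derivative_comp_neg (p : ℝ[X]) (k : ℕ) :
    (derivative^[k] p).comp (-X) = (-1) ^ k * derivative^[k] (p.comp (-X)) := by
  induction k with
  | zero => simp
  | succ k ih =>
    have h := derivative_comp_neg (derivative^[k] p)
    rw [Function.iterate_succ_apply', Function.iterate_succ_apply', eq_neg_iff_add_eq_zero.1 h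
      |> eq_neg_of_add_eq_zero_right, ih]
    rcases neg_one_pow_eq_or ℝ[X] k with h | h <;> simp [h, pow_succ]

lemma rodrigues_comp_neg (n : ℕ) : (rodrigues n).comp (-X) = (-1) ^ n * rodrigues n := by
  rw [rodrigues, iterate_derivative_comp_neg]
  simp

lemma natDegree_rodrigues_le (n : ℕ) : (rodrigues n).natDegree ≤ n := by
  have h1 : ((X ^ 2 - 1 : ℝ[X]) ^ n).natDegree ≤ n * 2 :=
    natDegree_pow_le_of_le n (by compute_degree)
  have h2 := natDegree_iterate_derivative ((X ^ 2 - 1 : ℝ[X]) ^ n) n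
  rw [rodrigues]
  omega

/-- Shifting by `1` turns `(X² - 1)^n` into `X^n (X + 2)^n`, so derivatives at `1` are binomial
coefficients. -/
lemma eval_one_iterate_derivative_rodrigues (n m : ℕ) :
    (derivative^[m] (rodrigues n)).eval 1 =
      ((n + m).factorial : ℝ) * (2 ^ (n - m) * (n.choose m : ℝ)) := by
  have h : taylor 1 ((X ^ 2 - 1 : ℝ[X]) ^ n) = X ^ n * (X + C 2) ^ n := by
    rw [taylor_apply, ← mul_pow]
    simp only [pow_comp, sub_comp, X_comp, one_comp, map_one]
    congr 1
    rw [show (C 2 : ℝ[X]) = 2 from rfl]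
    ring
  rw [rodrigues, ← Function.iterate_add_apply, add_comm m n, ← factorial_smul_hasseDeriv,
    LinearMap.smul_apply, eval_smul, ← taylor_coeff, h, add_comm n m, coeff_X_pow_mul,
    coeff_X_add_C_pow, nsmul_eq_mul]

lemma eval_one_rodrigues_pos (n : ℕ) : 0 < (rodrigues n).eval 1 := by
  have h := eval_one_iterate_derivative_rodrigues n 0
  rw [Function.iterate_zero_apply] at h
  rw [h]
  simp only [Nat.choose_zero_right]
  positivity

/-! ### The Neumann series and `F n` -/

/-- The polynomial solution `u` of `x u + u'' = Q'` with `Q = rodrigues n`, as a Neumann series. -/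
def neumann (n : ℕ) (x : ℝ) : ℝ[X] :=
  ∑ k ∈ Finset.range (n / 2 + 1), C ((-1) ^ k * (x⁻¹) ^ (k + 1)) * derivative^[2 * k + 1] (rodrigues n)

lemma neumann_equation (n : ℕ) {x : ℝ} (hx : x ≠ 0) :
    C x * neumann n x + derivative (derivative (neumann n x)) = derivative (rodrigues n) := by
  have key : ∀ M : ℕ, C x * (∑ k ∈ Finset.range M,
      C ((-1) ^ k * (x⁻¹) ^ (k + 1)) * derivative^[2 * k + 1] (rodrigues n)) +
      derivative (derivative (∑ k ∈ Finset.range M,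
      C ((-1) ^ k * (x⁻¹) ^ (k + 1)) * derivative^[2 * k + 1] (rodrigues n))) =
      derivative (rodrigues n) -
        C ((-1) ^ M * (x⁻¹) ^ M) * derivative^[2 * M + 1] (rodrigues n) := by
    intro M
    induction M with
    | zero => simp
    | succ M ih =>
      rw [Finset.sum_range_succ, mul_add, derivative_add, derivative_add, derivative_C_mul,
        derivative_C_mul, ← Function.iterate_succ_apply' derivative,
        ← Function.iterate_succ_apply' derivative, ← mul_assoc, ← C_mul, add_add_add_comm, ih,
        show x * ((-1) ^ M * x⁻¹ ^ (M + 1)) = (-1) ^ M * x⁻¹ ^ M by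
          rw [pow_succ, mul_left_comm, mul_comm _ x⁻¹, mul_inv_cancel_left₀ hx],
        show (2 * M + 1).succ.succ = 2 * (M + 1) + 1 by omega,
        show ((-1) ^ (M + 1) * x⁻¹ ^ (M + 1) : ℝ) = -((-1) ^ M * x⁻¹ ^ (M + 1)) by ring, C_neg]
      ring
  -- The telescoped remainder is a derivative of order `2⌊n/2⌋ + 3 > n`.
  have hlt : (rodrigues n).natDegree < 2 * (n / 2 + 1) + 1 := by
    have := natDegree_rodrigues_le n
    omega
  rw [neumann, key, iterate_derivative_eq_zero hlt, mul_zero, sub_zero]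

lemma degree_iterate_derivative_lt (p : ℝ[X]) {N : ℕ} (hp : p.degree < N) (k : ℕ) :
    (derivative^[k] p).degree < N := by
  induction k with
  | zero => exact hp
  | succ k ih =>
    rw [Function.iterate_succ_apply']
    exact degree_derivative_lt_of_lt ih

lemma degree_neumann_lt (n : ℕ) (x : ℝ) : (neumann n x).degree < n := by
  rw [neumann, ← mem_degreeLT]
  refine Submodule.sum_mem _ fun k _ => ?_
  rw [← smul_eq_C_mul]
  refine Submodule.smul_mem _ _ (mem_degreeLT.2 ?_)
  rw [Function.iterate_succ_apply]
  refine degree_iterate_derivative_lt _ (degree_derivative_add_one_lt ?_) _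
  exact degree_le_natDegree.trans_lt
    (Nat.cast_lt.2 (Nat.lt_succ_of_le (natDegree_rodrigues_le n)))

lemma neumann_comp_neg (n : ℕ) (x : ℝ) :
    (neumann n x).comp (-X) = -((-1) ^ n * neumann n x) := by
  rw [neumann, sum_comp, Finset.mul_sum, ← Finset.sum_neg_distrib]
  refine Finset.sum_congr rfl fun k _ => ?_
  rw [mul_comp, C_comp, iterate_derivative_comp_neg, rodrigues_comp_neg]
  rcases neg_one_pow_eq_or ℝ[X] n with h | h <;> simp [h, pow_succ, pow_mul]

/-- The difference on the right is `∑ (-1)^k x^(-k) Q^(2k)(1)`, with `Q = rodrigues n`. The values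
at `1` are explicit; the coefficients of `F n` are their ratios to `Q(1)`, in reversed order `j = ν
- k`. -/
lemma F_eval_mul (n : ℕ) {x : ℝ} (hx : x ≠ 0) :
    (F n).eval x * (rodrigues n).eval 1 =
      x ^ (n / 2) * ((rodrigues n).eval 1 - (derivative (neumann n x)).eval 1) := by
  have h1 : (rodrigues n).eval 1 - (derivative (neumann n x)).eval 1 =
      ∑ k ∈ Finset.range (n / 2 + 1),
        (-1) ^ k * (x⁻¹) ^ k * (derivative^[2 * k] (rodrigues n)).eval 1 := by
    have hlt : (rodrigues n).natDegree < 2 * (n / 2) + 1 + 1 := by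
      have := natDegree_rodrigues_le n
      omega
    rw [Finset.sum_range_succ', neumann, Finset.sum_range_succ, derivative_add, derivative_C_mul,
      ← Function.iterate_succ_apply' derivative, iterate_derivative_eq_zero hlt, mul_zero,
      add_zero, derivative_sum, eval_finsetSum]
    simp only [derivative_C_mul, eval_mul, eval_C, ← Function.iterate_succ_apply' derivative]
    rw [sub_eq_neg_add, ← Finset.sum_neg_distrib]
    congr 1
    · refine Finset.sum_congr rfl fun k _ => ?_
      rw [show (2 * k + 1).succ = 2 * (k + 1) by omega]
      ring
    · simp
  rw [h1, F, eval_finsetSum, ← Finset.sum_range_reflect, Finset.mul_sum, Finset.sum_mul]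
  refine Finset.sum_congr rfl fun k hk => ?_
  have hk' : k ≤ n / 2 := Nat.lt_succ_iff.1 (Finset.mem_range.1 hk)
  have hj : n / 2 + 1 - 1 - k = n / 2 - k := by omega
  have hkn : 2 * k ≤ n := by omega
  have h0 := eval_one_iterate_derivative_rodrigues n 0
  rw [Function.iterate_zero_apply] at h0
  have hasc : (ascPochhammer ℝ n).eval (2 * (k : ℝ) + 1) * ((2 * k).factorial : ℝ) =
      ((n + 2 * k).factorial : ℝ) := by
    have := ascPochhammer_eval_cast (S := ℝ) n (2 * k + 1)
    rw [Nat.cast_succ, Nat.cast_mul, Nat.cast_ofNat] at this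
    rw [← this, ascPochhammer_nat_eq_ascFactorial, mul_comm, ← Nat.cast_mul,
      Nat.factorial_mul_ascFactorial, add_comm]
  have hch : (n.choose (2 * k) : ℝ) * ((2 * k).factorial : ℝ) * ((n - 2 * k).factorial : ℝ) =
      (n.factorial : ℝ) := by exact_mod_cast Nat.choose_mul_factorial_mul_factorial hkn
  rw [hj, show 2 * (n / 2 - k) + n - 2 * (n / 2) = n - 2 * k by omega,
    eval_one_iterate_derivative_rodrigues, h0, Nat.cast_sub hk', Nat.cast_sub hk',
    show 2 * ((n / 2 : ℕ) : ℝ) - 2 * (((n / 2 : ℕ) : ℝ) - (k : ℝ)) + 1 = 2 * (k : ℝ) + 1 by ring,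
    show ((n / 2 : ℕ) : ℤ) - (k : ℤ) - ((n / 2 : ℕ) : ℤ) = -(k : ℤ) by ring,
    zpow_neg, zpow_natCast, eval_mul, eval_C, eval_pow, eval_X, ← hasc,
    show (-4 : ℝ) = -1 * 2 ^ 2 by norm_num, mul_pow, ← pow_mul]
  have hx' : x ^ (n / 2) = x ^ (n / 2 - k) * x ^ k := by rw [← pow_add]; congr 1; omega
  have h2' : (2 : ℝ) ^ n = 2 ^ (n - 2 * k) * 2 ^ (2 * k) := by rw [← pow_add]; congr 1; omega
  have hm : ((-1 : ℝ) ^ k) * (-1) ^ k = 1 := by rw [← mul_pow]; norm_num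
  have hf : ((n - 2 * k).factorial : ℝ) ≠ 0 := by positivity
  have hm' : ((-1 : ℝ) ^ k)⁻¹ = (-1) ^ k := inv_eq_of_mul_eq_one_left hm
  simp only [Nat.sub_zero, Nat.add_zero, Nat.choose_zero_right, mul_inv]
  rw [hm', h2', hx', inv_pow, ← hch]
  field_simp
  simp

lemma eval_neg_one_of_comp_neg {p : ℝ[X]} {k : ℕ} (h : p.comp (-X) = (-1) ^ k * p) :
    p.eval (-1) = (-1) ^ k * p.eval 1 := by
  simpa using congrArg (eval 1) h

lemma eval_neg_one_derivative_of_comp_neg {p : ℝ[X]} {k : ℕ} (h : p.comp (-X) = (-1) ^ k * p) :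
    (derivative p).eval (-1) = -(-1) ^ k * (derivative p).eval 1 := by
  have h1 := derivative_comp_neg p
  rw [h, show (-1 : ℝ[X]) ^ k = C ((-1) ^ k) by simp, derivative_C_mul] at h1
  have h2 := congrArg (eval 1) h1
  simp only [eval_mul, eval_C, eval_neg, eval_comp, eval_X] at h2
  linarith

/-- The second derivative has smaller degree, so it cannot cancel the leading term of `x v`. -/
lemma eq_zero_of_equation {x : ℝ} (hx : x ≠ 0) {v : ℝ[X]}
    (h : C x * v + derivative (derivative v) = 0) : v = 0 := by
  by_contra hv
  have h1 : (C x * v).degree = v.degree := degree_C_mul hx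
  rw [eq_neg_of_add_eq_zero_left h, degree_neg] at h1
  exact absurd h1 (degree_derivative_le.trans_lt (degree_derivative_lt hv)).ne

/-- Since `q'` is orthogonal to `rodrigues n`, only the boundary terms survive. -/
lemma integ_derivative_rodrigues_mul {n : ℕ} {q : ℝ[X]} (hq : q.degree < (n + 1 : ℕ)) :
    integ (derivative (rodrigues n) * q) =
      (rodrigues n).eval 1 * (q.eval 1 - (-1) ^ n * q.eval (-1)) := by
  rw [integ_derivative_mul, integ_rodrigues_mul (degree_derivative_add_one_lt hq),
    eval_neg_one_of_comp_neg (rodrigues_comp_neg n)]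
  ring

/-- Test the equation for `w = neumann n x` with `w` itself. By parity the boundary terms are `2
Q(1) w(1)` and `2 w'(1) w(1)`, which cancel because `Q(1) = w'(1)` at a root. -/
lemma exists_rayleigh_eq_of_isRoot {n : ℕ} {x : ℝ} (hx : 0 < x)
    (hF : (F n).IsRoot x) :
    ∃ w : ℝ[X], w ≠ 0 ∧ w.degree < n ∧
      integ (derivative w * derivative w) = x * integ (w * w) := by
  have h1 := F_eval_mul n hx.ne'
  rw [hF.eq_zero, zero_mul, eq_comm, mul_eq_zero, or_iff_right (pow_ne_zero _ hx.ne')] at h1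
  have heq := neumann_equation n hx.ne'
  have hdeg := degree_neumann_lt n x
  refine ⟨neumann n x, ?_, hdeg, ?_⟩
  · intro h0
    rw [h0] at h1
    simp only [derivative_zero, eval_zero, sub_zero] at h1
    exact (eval_one_rodrigues_pos n).ne' h1
  · have h2 : (neumann n x).comp (-X) = (-1) ^ (n + 1) * neumann n x := by
      rw [neumann_comp_neg]; ring
    have h4 := eval_neg_one_of_comp_neg h2
    have h5 := eval_neg_one_derivative_of_comp_neg h2
    have h6 := integ_derivative_mul (derivative (neumann n x)) (neumann n x)
    have h7 := integ_derivative_rodrigues_mul (hdeg.trans (by exact_mod_cast n.lt_succ_self))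
    have h8 : ((-1 : ℝ) ^ n) * (-1) ^ n = 1 := by rw [← mul_pow]; norm_num
    rw [← heq, add_mul, map_add, mul_assoc, integ_C_mul] at h7
    rw [h4, h5, pow_succ] at h6
    rw [h4, pow_succ] at h7
    linear_combination h6 - h7 - (eval 1 (neumann n x)) * (1 + (-1) ^ n * (-1) ^ n) * h1

/-- A maximizer of the Rayleigh quotient has the parity of its degree. -/
lemma IsEigen.comp_neg_eq {N : ℕ} {x : ℝ} {u : ℝ[X]} (hx : 0 < x) (hu : IsEigen (N + 1) x u)
    (hmax : ∀ p : ℝ[X], p.degree < (N + 1 : ℕ) →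
      integ (derivative p * derivative p) ≤ x * integ (p * p)) :
    u.comp (-X) = (-1) ^ N * u := by
  have hs : (-1 : ℝ) ^ N * (-1) ^ N = 1 := by rw [← mul_pow]; norm_num
  -- The coefficient of `X^N` cancels in `d`, so if `d ≠ 0` then `X * d` is admissible and violates
  -- `hmax`.
  set d : ℝ[X] := u - C ((-1) ^ N) * u.comp (-X) with hd
  have hdE : IsEigen (N + 1) x d := hu.sub (hu.comp_neg.C_mul _)
  have hcoeff : d.coeff N = 0 := by
    rw [hd, coeff_sub, coeff_C_mul, show (-X : ℝ[X]) = C (-1) * X by simp, comp_C_mul_X_coeff,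
      mul_left_comm, hs, mul_one, sub_self]
  have hdeg : d.degree < N := by
    refine (degree_lt_iff_coeff_zero _ _).2 fun m hm => ?_
    rcases hm.eq_or_lt with rfl | hm
    · exact hcoeff
    · exact coeff_eq_zero_of_degree_lt (hdE.degree_lt.trans_le (by exact_mod_cast hm))
  have hd0 : d = 0 := by
    by_contra hne
    refine absurd (hmax (X * d) ?_) (not_le.2 (hdE.lt_of_degree_lt hx hne hdeg))
    have h1 := (natDegree_lt_iff_degree_lt hne).2 hdeg
    refine degree_le_natDegree.trans_lt (Nat.cast_lt.2 ?_)
    rw [natDegree_X_mul hne]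
    omega
  have h2 := congrArg (fun p => C ((-1 : ℝ) ^ N) * p) (sub_eq_zero.1 (hd ▸ hd0))
  rw [← mul_assoc, ← Polynomial.C_mul, hs, map_one, one_mul] at h2
  rw [← h2]
  simp

/-- The maximal Rayleigh quotient among polynomials of degree less than `n` is a root of `F n`. -/
lemma IsEigen.isRoot_F {N : ℕ} {x : ℝ} {u : ℝ[X]} (hx : 0 < x) (hu : IsEigen (N + 1) x u)
    (hu0 : u ≠ 0)
    (hmax : ∀ p : ℝ[X], p.degree < (N + 1 : ℕ) →
      integ (derivative p * derivative p) ≤ x * integ (p * p)) :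
    (F (N + 1)).IsRoot x := by
  have hpar := hu.comp_neg_eq hx hmax
  have hd1 := eval_neg_one_derivative_of_comp_neg hpar
  have hQ := eval_one_rodrigues_pos (N + 1)
  set Q := rodrigues (N + 1) with hQdef
  set c := (derivative u).eval 1 with hc
  set w := neumann (N + 1) x with hw
  have heq : C x * w + derivative (derivative w) = derivative Q := neumann_equation (N + 1) hx.ne'
  -- By parity, `x u + u''` and `Q'` represent the same boundary functional up to the factors `c`
  -- and `Q(1)`. Their combination has degree `< N + 1`, so it can be tested against itself.
  have hr : ∀ q : ℝ[X], q.degree < (N + 1 : ℕ) →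
      integ ((C (Q.eval 1) * (C x * u + derivative (derivative u)) - C c * derivative Q) * q)
        = 0 := by
    intro q hq
    have h1 := hu.integ_eq q hq
    have h2 := integ_derivative_mul (derivative u) q
    have h3 := integ_derivative_rodrigues_mul (hq.trans
      (by exact_mod_cast (N + 1).lt_succ_self : ((N + 1 : ℕ) : WithBot ℕ) < (N + 1 + 1 : ℕ)))
    rw [hd1, ← hc] at h2
    rw [sub_mul, map_sub, mul_assoc, mul_assoc, integ_C_mul, integ_C_mul, add_mul, map_add,
      mul_assoc, integ_C_mul, h2, h1, h3]
    ring
  have hQ' : (derivative Q).degree < (N + 1 : ℕ) :=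
    degree_derivative_add_one_lt (degree_le_natDegree.trans_lt
      (Nat.cast_lt.2 (Nat.lt_succ_of_le (natDegree_rodrigues_le _))))
  have he : C (Q.eval 1) * (C x * u + derivative (derivative u)) - C c * derivative Q = 0 := by
    by_contra hne
    refine (integ_mul_self_pos hne).ne' (hr _ (mem_degreeLT.1 ?_))
    simp only [← smul_eq_C_mul]
    refine sub_mem (Submodule.smul_mem _ _ (add_mem (Submodule.smul_mem _ _ ?_) ?_))
      (Submodule.smul_mem _ _ (mem_degreeLT.2 hQ'))
    · exact mem_degreeLT.2 hu.degree_lt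
    · exact mem_degreeLT.2 (degree_derivative_lt_of_lt (degree_derivative_lt_of_lt hu.degree_lt))
  have hv : C (Q.eval 1) * u - C c * w = 0 := by
    refine eq_zero_of_equation hx.ne' ?_
    rw [← heq] at he
    simp only [derivative_sub, derivative_C_mul]
    rw [← he]
    ring
  have hev := congrArg (fun p => (derivative p).eval 1) hv
  simp only [derivative_sub, derivative_C_mul, eval_sub, eval_mul, eval_C, derivative_zero,
    eval_zero, ← hc] at hev
  have hc0 : c ≠ 0 := by
    intro h0
    rw [h0, map_zero, zero_mul, sub_zero, mul_eq_zero, C_eq_zero] at hv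
    exact hv.elim hQ.ne' hu0
  have h1 := F_eval_mul (N + 1) hx.ne'
  have h2 : Q.eval 1 - (derivative w).eval 1 = 0 := by
    refine (mul_eq_zero.1 (?_ : c * _ = 0)).resolve_left hc0
    linear_combination hev
  rw [← hQdef, ← hw, h2, mul_zero] at h1
  exact (mul_eq_zero.1 h1).resolve_right hQ.ne'

/-! ### Existence of a maximizer -/

/-- The polynomial with coefficient vector `v`. -/
def toPoly {n : ℕ} (v : Fin n → ℝ) : ℝ[X] := ∑ i, C (v i) * X ^ (i : ℕ)

lemma degree_toPoly_lt {n : ℕ} (v : Fin n → ℝ) : (toPoly v).degree < n := by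
  rw [toPoly, ← mem_degreeLT]
  refine Submodule.sum_mem _ fun i _ => mem_degreeLT.2 ?_
  exact (degree_C_mul_X_pow_le _ _).trans_lt (Nat.cast_lt.2 i.2)

lemma coeff_toPoly {n : ℕ} (v : Fin n → ℝ) (i : Fin n) : (toPoly v).coeff i = v i := by
  simp only [toPoly, finsetSum_coeff, coeff_C_mul, coeff_X_pow, Fin.val_inj, mul_ite, mul_one,
    mul_zero]
  simp

lemma exists_toPoly_eq {n : ℕ} {p : ℝ[X]} (hp : p.degree < n) :
    ∃ v : Fin n → ℝ, toPoly v = p := by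
  refine ⟨fun i => p.coeff i, ?_⟩
  ext k
  by_cases hk : k < n
  · exact coeff_toPoly _ ⟨k, hk⟩
  · have hk' : (n : WithBot ℕ) ≤ k := by exact_mod_cast not_lt.1 hk
    rw [coeff_eq_zero_of_degree_lt ((degree_toPoly_lt _).trans_le hk'),
      coeff_eq_zero_of_degree_lt (hp.trans_le hk')]

lemma toPoly_ne_zero {n : ℕ} {v : Fin n → ℝ} (hv : v ≠ 0) : toPoly v ≠ 0 := fun h =>
  hv (funext fun i => by rw [← coeff_toPoly v i, h]; simp)

lemma toPoly_smul {n : ℕ} (c : ℝ) (v : Fin n → ℝ) : toPoly (c • v) = C c * toPoly v := by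
  simp [toPoly, Finset.mul_sum, mul_assoc]

lemma continuous_integ_toPoly {n : ℕ} (L : ℝ[X] →ₗ[ℝ] ℝ[X]) :
    Continuous fun v : Fin n → ℝ => integ (L (toPoly v) * L (toPoly v)) := by
  have : (fun v : Fin n → ℝ => integ (L (toPoly v) * L (toPoly v))) =
      fun v => ∑ i : Fin n, ∑ j : Fin n, v i * v j * integ (L (X ^ (i : ℕ)) * L (X ^ (j : ℕ))) := by
    funext v
    simp only [toPoly, map_sum, ← smul_eq_C_mul, map_smul, Finset.sum_mul_sum, smul_mul_smul_comm,
      smul_eq_mul]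
  rw [this]
  fun_prop

/-- The Rayleigh quotient attains its maximum on the polynomials of degree less than `n`. -/
lemma exists_max_rayleigh {n : ℕ} (hn : n ≠ 0) :
    ∃ x : ℝ, (∀ p : ℝ[X], p.degree < n →
      integ (derivative p * derivative p) ≤ x * integ (p * p)) ∧
      ∃ u : ℝ[X], u ≠ 0 ∧ u.degree < n ∧
        integ (derivative u * derivative u) = x * integ (u * u) := by
  have : Nonempty (Fin n) := ⟨⟨0, Nat.pos_of_ne_zero hn⟩⟩
  have hne : ∀ v ∈ Metric.sphere (0 : Fin n → ℝ) 1, v ≠ 0 := fun v hv =>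
    ne_zero_of_mem_unit_sphere ⟨v, hv⟩
  have hc : ContinuousOn (fun v : Fin n → ℝ =>
      integ (derivative (toPoly v) * derivative (toPoly v)) / integ (toPoly v * toPoly v))
      (Metric.sphere 0 1) :=
    (continuous_integ_toPoly derivative).continuousOn.div
      (continuous_integ_toPoly LinearMap.id).continuousOn
      fun v hv => (integ_mul_self_pos (toPoly_ne_zero (hne v hv))).ne'
  obtain ⟨v, hv, hmax⟩ := (isCompact_sphere (0 : Fin n → ℝ) 1).exists_isMaxOn
    (NormedSpace.sphere_nonempty.2 zero_le_one) hc
  refine ⟨_, fun p hp => ?_, toPoly v, toPoly_ne_zero (hne v hv), degree_toPoly_lt v,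
    (div_mul_cancel₀ _ (integ_mul_self_pos (toPoly_ne_zero (hne v hv))).ne').symm⟩
  obtain ⟨q, rfl⟩ := exists_toPoly_eq hp
  by_cases hq : q = 0
  · simp [hq, toPoly]
  · have hq0 : ‖q‖ ≠ 0 := norm_ne_zero_iff.2 hq
    have h1 := hmax (show ‖q‖⁻¹ • q ∈ Metric.sphere (0 : Fin n → ℝ) 1 by
      rw [mem_sphere_zero_iff_norm, norm_smul, norm_inv, norm_norm, inv_mul_cancel₀ hq0])
    have e : ∀ r : ℝ[X], integ (C ‖q‖⁻¹ * r * (C ‖q‖⁻¹ * r)) =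
        (‖q‖⁻¹ * ‖q‖⁻¹) * integ (r * r) := fun r => by
      rw [← integ_C_mul, C_mul]
      congr 1
      ring
    simp only [Set.mem_ofPred_eq, toPoly_smul, derivative_C_mul] at h1
    rw [e, e, mul_div_mul_left _ _ (mul_ne_zero (inv_ne_zero hq0) (inv_ne_zero hq0)),
      div_le_iff₀ (integ_mul_self_pos (toPoly_ne_zero hq))] at h1
    exact h1

/-- A maximizer of the Rayleigh quotient solves the eigenvalue problem. -/
lemma isEigen_of_max {n : ℕ} {x : ℝ} {u : ℝ[X]}
    (hmax : ∀ p : ℝ[X], p.degree < n → integ (derivative p * derivative p) ≤ x * integ (p * p))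
    (hu : u.degree < n) (heq : integ (derivative u * derivative u) = x * integ (u * u)) :
    IsEigen n x u where
  degree_lt := hu
  integ_eq q hq := by
    -- The defect of `u + t q` in `hmax` is a nonnegative quadratic in `t` without constant term, so
    -- its linear coefficient vanishes.
    have key : ∀ t : ℝ, 0 ≤
        (x * integ (q * q) - integ (derivative q * derivative q)) * (t * t) +
        (2 * (x * integ (u * q) - integ (derivative u * derivative q))) * t + 0 := by
      intro t
      have h1 := hmax (u + C t * q) (mem_degreeLT.1 (add_mem (mem_degreeLT.2 hu)
        (by rw [← smul_eq_C_mul]; exact Submodule.smul_mem _ _ (mem_degreeLT.2 hq))))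
      have e : ∀ a c : ℝ[X], integ ((a + C t * c) * (a + C t * c)) =
          integ (a * a) + 2 * t * integ (a * c) + t * t * integ (c * c) := fun a c => by
        rw [← integ_C_mul, ← integ_C_mul, ← map_add, ← map_add]
        congr 1
        simp only [C_mul, show (C 2 : ℝ[X]) = 2 from rfl]
        ring
      rw [derivative_add, derivative_C_mul, e, e, heq] at h1
      linarith
    have h2 := discrim_le_zero key
    rw [discrim, mul_zero, sub_zero] at h2
    have h3 := pow_eq_zero_iff (two_ne_zero) |>.1 (le_antisymm h2 (sq_nonneg _))
    linarith

/-! ### The matrix pencil -/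

lemma integ_X_pow (k : ℕ) : integ (X ^ k) = (1 - (-1) ^ (k + 1)) / (k + 1) := by
  simp only [integ_apply, eval_pow, eval_X, integral_pow, one_pow]

lemma A_apply {n : ℕ} (i j : Fin n) : A n i j = integ (X ^ (i : ℕ) * X ^ (j : ℕ)) := by
  rw [← pow_add, integ_X_pow, A, Matrix.of_apply, a]
  rw [show (((i : ℕ) + 1 : ℕ) : ℤ) + (((j : ℕ) + 1 : ℕ) : ℤ) - 1 = ((i + j + 1 : ℕ) : ℤ) by
    push_cast; ring, zpow_natCast]
  congr 1
  push_cast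
  ring

lemma B_apply {n : ℕ} (i j : Fin n) :
    B n i j = integ (derivative (X ^ (i : ℕ)) * derivative (X ^ (j : ℕ))) := by
  rw [B, Matrix.of_apply]
  generalize (i : ℕ) = k
  generalize (j : ℕ) = l
  rcases k with _ | k
  · simp [b]
  rcases l with _ | l
  · simp [b]
  rw [derivative_X_pow, derivative_X_pow, Nat.add_sub_cancel, Nat.add_sub_cancel,
    mul_mul_mul_comm, ← pow_add, ← C_mul, integ_C_mul, integ_X_pow, b]
  rw [show ((k + 1 + 1 : ℕ) : ℤ) + ((l + 1 + 1 : ℕ) : ℤ) - 3 = ((k + l + 1 : ℕ) : ℤ) by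
    push_cast; ring, zpow_natCast]
  congr 1
  · push_cast; ring
  · congr 1
    push_cast
    ring

lemma A_mulVec {n : ℕ} (v : Fin n → ℝ) (i : Fin n) :
    (A n).mulVec v i = integ (X ^ (i : ℕ) * toPoly v) := by
  simp only [Matrix.mulVec, dotProduct, A_apply, toPoly, Finset.mul_sum, map_sum, ← smul_eq_C_mul,
    mul_smul_comm, map_smul, smul_eq_mul]
  exact Finset.sum_congr rfl fun _ _ => mul_comm _ _

lemma B_mulVec {n : ℕ} (v : Fin n → ℝ) (i : Fin n) :
    (B n).mulVec v i = integ (derivative (X ^ (i : ℕ)) * derivative (toPoly v)) := by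
  simp only [Matrix.mulVec, dotProduct, B_apply, toPoly, Finset.mul_sum, map_sum, ← smul_eq_C_mul,
    mul_smul_comm, map_smul, smul_eq_mul]
  exact Finset.sum_congr rfl fun _ _ => mul_comm _ _

lemma det_eq_zero_of_isEigen {n : ℕ} {x : ℝ} {u : ℝ[X]} (hu0 : u ≠ 0) (hu : IsEigen n x u) :
    (B n - x • A n).det = 0 := by
  obtain ⟨v, rfl⟩ := exists_toPoly_eq hu.degree_lt
  refine Matrix.exists_mulVec_eq_zero_iff.1 ⟨v, ?_, ?_⟩
  · rintro rfl
    simp [toPoly] at hu0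
  · funext i
    rw [Matrix.sub_mulVec, Matrix.smul_mulVec, Pi.sub_apply, Pi.smul_apply, A_mulVec, B_mulVec,
      mul_comm, mul_comm (X ^ (i : ℕ)), hu.integ_eq _ ((degree_X_pow_le _).trans_lt
        (Nat.cast_lt.2 i.2)), smul_eq_mul, sub_self, Pi.zero_apply]

/-- Pairing a kernel vector with its own equation gives a Rayleigh quotient equal to `x`, which is
all the upper bound on roots requires. -/
lemma exists_rayleigh_eq_of_det_eq_zero {n : ℕ} {x : ℝ} (h : (B n - x • A n).det = 0) :
    ∃ w : ℝ[X], w ≠ 0 ∧ w.degree < n ∧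
      integ (derivative w * derivative w) = x * integ (w * w) := by
  obtain ⟨v, hv, h0⟩ := Matrix.exists_mulVec_eq_zero_iff.2 h
  refine ⟨toPoly v, toPoly_ne_zero hv, degree_toPoly_lt v, ?_⟩
  have h1 : ∀ i : Fin n, integ (derivative (X ^ (i : ℕ)) * derivative (toPoly v)) =
      x * integ (X ^ (i : ℕ) * toPoly v) := fun i => by
    have := congrFun h0 i
    rw [Matrix.sub_mulVec, Matrix.smul_mulVec, Pi.sub_apply, Pi.smul_apply, A_mulVec, B_mulVec,
      smul_eq_mul, Pi.zero_apply] at this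
    linarith
  -- The second factor is kept general so that unfolding `toPoly` expands only the first.
  have h2 : ∀ p : ℝ[X], (∀ i : Fin n, integ (derivative (X ^ (i : ℕ)) * derivative p) =
      x * integ (X ^ (i : ℕ) * p)) →
      integ (derivative (toPoly v) * derivative p) = x * integ (toPoly v * p) := by
    intro p hp
    simp only [toPoly, Finset.sum_mul, map_sum, derivative_C_mul, mul_assoc,
      integ_C_mul, hp, Finset.mul_sum]
    exact Finset.sum_congr rfl fun _ _ => by ring
  exact h2 _ h1

/-! ### Reduction from the square to the interval -/

lemma integrableOn_square {h : ℝ × ℝ → ℝ} (hh : Continuous h) : IntegrableOn h square :=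
  (hh.continuousOn.integrableOn_compact (isCompact_Icc.prod isCompact_Icc)).mono_set
    (Set.prod_mono Set.Ioo_subset_Icc_self Set.Ioo_subset_Icc_self)

lemma integral_square {h : ℝ × ℝ → ℝ} (hh : Continuous h) :
    ∫ p in square, h p = ∫ y in Set.Ioo (-1 : ℝ) 1, ∫ x in (-1 : ℝ)..1, h (x, y) := by
  have hi := integrableOn_square hh
  rw [IntegrableOn, square, Measure.volume_eq_prod, ← Measure.prod_restrict] at hi
  rw [square, Measure.volume_eq_prod, ← Measure.prod_restrict, integral_prod_symm _ hi]
  congr 1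
  funext y
  rw [intervalIntegral.integral_of_le (by norm_num), integral_Ioc_eq_integral_Ioo]

/-- The functions in `V n` are polynomials of degree less than `n` in the first variable. -/
lemma exists_slices {n : ℕ} {v : ℝ × ℝ → ℝ} (hv : v ∈ V n) :
    Continuous v ∧ ∃ g : ℝ → ℝ[X], (∀ y, (g y).degree < n) ∧ (∀ p, v p = (g p.2).eval p.1) ∧
      Continuous fun p : ℝ × ℝ => (derivative (g p.2)).eval p.1 := by
  induction hv using Submodule.span_induction with
  | mem v hv =>
    obtain ⟨i, hi, j, -, rfl⟩ := hv
    refine ⟨by fun_prop, fun y => C (y ^ j) * X ^ i, fun y => ?_, fun p => ?_, ?_⟩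
    · exact (degree_C_mul_X_pow_le _ _).trans_lt (Nat.cast_lt.2 hi)
    · simp [mul_comm]
    · simp only [derivative_C_mul, derivative_X_pow, eval_mul, eval_C, eval_pow, eval_X]
      fun_prop
  | zero => exact ⟨continuous_const, 0, by simp, by simp, by simpa using continuous_const⟩
  | add u v _ _ hu hv =>
    obtain ⟨hu, g, hg1, hg2, hg3⟩ := hu
    obtain ⟨hv, k, hk1, hk2, hk3⟩ := hv
    refine ⟨hu.add hv, g + k, fun y => ?_, fun p => ?_, ?_⟩
    · exact (degree_add_le _ _).trans_lt (max_lt (hg1 y) (hk1 y))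
    · simp [hg2, hk2]
    · simp only [Pi.add_apply, derivative_add, eval_add]
      exact hg3.add hk3
  | smul c v _ hv =>
    obtain ⟨hv, g, hg1, hg2, hg3⟩ := hv
    refine ⟨hv.const_smul c, c • g, fun y => ?_, fun p => ?_, ?_⟩
    · exact (degree_smul_le _ _).trans_lt (hg1 y)
    · simp [hg2]
    · simpa using hg3.const_mul c

lemma dx_eq {v : ℝ × ℝ → ℝ} {g : ℝ → ℝ[X]} (hg : ∀ p, v p = (g p.2).eval p.1) :
    dx v = fun p => (derivative (g p.2)).eval p.1 := by
  funext p
  simp only [dx, hg]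
  exact Polynomial.deriv _

/-- Integrate over `y` the one-dimensional inequality for each slice. -/
lemma innerX_le {n : ℕ} {x : ℝ}
    (hmax : ∀ p : ℝ[X], p.degree < n → integ (derivative p * derivative p) ≤ x * integ (p * p))
    {v : ℝ × ℝ → ℝ} (hv : v ∈ V n) : innerX v v ≤ x * innerY v v := by
  obtain ⟨hc, g, hg1, hg2, hg3⟩ := exists_slices hv
  have hc' : Continuous (dx v) := by rwa [dx_eq hg2]
  have h0 : 0 ≤ ∫ p in square, (x * (v p * v p) - dx v p * dx v p) := by
    rw [integral_square (by fun_prop)]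
    refine integral_nonneg fun y => ?_
    have h1 := hmax (g y) (hg1 y)
    have h2 : ∫ s in (-1 : ℝ)..1, (x * (v (s, y) * v (s, y)) - dx v (s, y) * dx v (s, y)) =
        integ (C x * (g y * g y) - derivative (g y) * derivative (g y)) := by
      simp only [integ_apply, dx_eq hg2, hg2, eval_sub, eval_mul, eval_C]
    rw [Pi.zero_apply, h2, map_sub, integ_C_mul]
    linarith
  rw [integral_sub ((integrableOn_square (by fun_prop : Continuous fun p => v p * v p)).const_mul x)
    (integrableOn_square (by fun_prop)), integral_const_mul] at h0
  exact sub_nonneg.1 h0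

lemma comp_fst_mem_V {n : ℕ} (hn : n ≠ 0) {u : ℝ[X]} (hu : u.degree < n) :
    (fun p : ℝ × ℝ => u.eval p.1) ∈ V n := by
  obtain ⟨c, rfl⟩ := exists_toPoly_eq hu
  have : (fun p : ℝ × ℝ => (toPoly c).eval p.1) =
      ∑ i, c i • fun p : ℝ × ℝ => p.1 ^ (i : ℕ) * p.2 ^ 0 := by
    funext p
    simp [toPoly, eval_finsetSum]
  rw [this]
  exact Submodule.sum_mem _ fun i _ => Submodule.smul_mem _ _
    (Submodule.subset_span ⟨i, i.2, 0, Nat.pos_of_ne_zero hn, rfl⟩)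

lemma innerY_comp_fst (u : ℝ[X]) :
    innerY (fun p => u.eval p.1) (fun p => u.eval p.1) = 2 * integ (u * u) := by
  rw [innerY, integral_square (by fun_prop)]
  simp only [← eval_mul, ← integ_apply, setIntegral_const, smul_eq_mul]
  norm_num

lemma innerX_comp_fst (u : ℝ[X]) :
    innerX (fun p => u.eval p.1) (fun p => u.eval p.1) =
      2 * integ (derivative u * derivative u) := by
  rw [← innerY_comp_fst, innerX, innerY, dx_eq (g := fun _ => u) fun _ => rfl]

/-- The supremum is attained by the one-dimensional maximizer, extended constantly in `y`. -/
lemma isGreatest_quotients {n : ℕ} (hn : n ≠ 0) {x : ℝ} (hx : 0 ≤ x)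
    (hmax : ∀ p : ℝ[X], p.degree < n → integ (derivative p * derivative p) ≤ x * integ (p * p))
    {u : ℝ[X]} (hu0 : u ≠ 0) (hu : u.degree < n)
    (heq : integ (derivative u * derivative u) = x * integ (u * u)) :
    IsGreatest (quotients n) (Real.sqrt x) := by
  constructor
  · refine ⟨fun p => u.eval p.1, comp_fst_mem_V hn hu, fun h => hu0 ?_, ?_⟩
    · exact Polynomial.funext fun s => by simpa using congrFun h (s, 0)
    · have := integ_mul_self_pos hu0
      rw [normX, normY, innerX_comp_fst, innerY_comp_fst, heq, ← Real.sqrt_div' _ (by positivity)]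
      congr 1
      field_simp
  · rintro _ ⟨v, hv, -, rfl⟩
    -- This form also covers a zero denominator, so positivity of `normY v` is not needed.
    refine div_le_of_le_mul₀ (Real.sqrt_nonneg _) (Real.sqrt_nonneg _) ?_
    rw [normX, normY, ← Real.sqrt_mul hx]
    exact Real.sqrt_le_sqrt (innerX_le hmax hv)

lemma pos_of_max {n : ℕ} (hn : 2 ≤ n) {x : ℝ}
    (hmax : ∀ p : ℝ[X], p.degree < n → integ (derivative p * derivative p) ≤ x * integ (p * p)) :
    0 < x := by
  have h := hmax X (degree_X_le.trans_lt (by exact_mod_cast hn))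
  rw [derivative_X] at h
  have h1 := integ_mul_self_pos (one_ne_zero : (1 : ℝ[X]) ≠ 0)
  have h2 := integ_mul_self_nonneg X
  by_contra hx
  nlinarith

end InverseInequality

end

open InverseInequality in
theorem mainTheorem6 (n : ℕ) (hn : 2 ≤ n) :
    ∃ lam : ℝ,
      IsGreatest {x : ℝ | (InverseInequality.F n).IsRoot x} lam ∧
      IsGreatest {x : ℝ | (InverseInequality.B n - x • InverseInequality.A n).det = 0} lam ∧
      IsLUB (InverseInequality.quotients n) (InverseInequality.cHat n) ∧
      InverseInequality.cHat n ^ 2 = lam := by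
  have hn0 : n ≠ 0 := by omega
  obtain ⟨lam, hmax, u, hu0, hu, heq⟩ := exists_max_rayleigh hn0
  have hpos := pos_of_max hn hmax
  have hE := isEigen_of_max hmax hu heq
  have hle : ∀ {x : ℝ}, (∃ w : Polynomial ℝ, w ≠ 0 ∧ w.degree < n ∧
      integ (Polynomial.derivative w * Polynomial.derivative w) = x * integ (w * w)) →
      x ≤ lam := by
    rintro x ⟨w, hw0, hw, hwx⟩
    exact le_of_mul_le_mul_right (hwx ▸ hmax w hw) (integ_mul_self_pos hw0)
  have hg := isGreatest_quotients hn0 hpos.le hmax hu0 hu heq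
  have hc : cHat n = Real.sqrt lam := hg.csSup_eq
  refine ⟨lam, ⟨?_, fun x hx => ?_⟩, ⟨det_eq_zero_of_isEigen hu0 hE,
    fun x hx => hle (exists_rayleigh_eq_of_det_eq_zero hx)⟩, ?_, ?_⟩
  · obtain ⟨N, rfl⟩ := Nat.exists_eq_succ_of_ne_zero hn0
    exact hE.isRoot_F hpos hu0 hmax
  -- The Neumann series argument needs `x > 0`; other roots lie below `lam` trivially.
  · rcases le_or_gt x 0 with h | h
    · exact h.trans hpos.le
    · exact hle (exists_rayleigh_eq_of_isRoot h hx)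
  · rw [hc]
    exact hg.isLUB
  · rw [hc, Real.sq_sqrt hpos.le]
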